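/- Let $A=\{0,1,\dots,n-1\}$ with $n\ge 2$, and let $X=X_1,X_2,\dots$ (the plaintext) and $Y=Y_1,Y_2,\dots$ (the key) be processes with values in $A$ on a probability space that are jointly stationary and ergodic, i.e. the law of the pair process $(X_i,Y_i)_{i\ge1}$ on the space of sequences is invariant and ergodic under the shift. Let $c,d:A\times A\to A$ satisfy $d(c(x,y),y)=x$ for all $x,y\in A$, and let $Z_i=c(X_i,Y_i)$ be the ciphertext. All logarithms are to base $2$. For a process $W$ over a finite alphabet $B$ put $h_m(W)=-\frac1{m+1}\sum_{u\in B^{m+1}}P(W_1\dots W_{m+1}=u)\log P(W_1\dots W_{m+1}=u)$, and let $h_m(X|Z)=h_m(X,Z)-h_m(Z)$ and $h(X|Z)=\lim_{m\to\infty}h_m(X|Z)$. This limit exists. For words $x,z\in A^t$ write $P(x|z)=P(X_1\dots X_t=x\mid Z_1\dots Z_t=z)$, and for $S\subseteq A^t$ write $P(S|z)=\sum_{x\in S}P(x|z)$. Then for every $\varepsilon>0$ and $\delta>0$ one can assign to every $t$ and every $z\in A^t$ a set $\Psi(z)\subseteq A^t$ such that, for almost every realization $Z_1,Z_2,\dots$,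 there is an integer $n'$ (which may depend on the realization) such that for every $t>n'$ the set $\Psi(Z)=\Psi(Z_1\dots Z_t)$ is non-empty, consists of words of positive conditional probability given $Z_1\dots Z_t$, and satisfies (i) $P(\Psi(Z)\mid Z_1\dots Z_t)>1-\delta$; (ii) $\frac1t\left|\log P(x^1|Z_1\dots Z_t)-\log P(x^2|Z_1\dots Z_t)\right|<\varepsilon$ for all $x^1,x^2\in\Psi(Z)$; and, moreover, for almost every realization, (iii) $\liminf_{t\to\infty}\frac1t\log|\Psi(Z_1\dots Z_t)|\ge h(X|Z)$. -/

import Mathlib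

open MeasureTheory ProbabilityTheory Filter Topology

namespace RunningKey

/-- The one-sided shift on sequences. -/
def shift {α : Type*} (x : ℕ → α) : ℕ → α := fun i => x (i + 1)

/-- A process `W 0, W 1, …` with values in `α` is stationary and ergodic: its law on the space of
sequences is invariant and ergodic under the shift (`Ergodic` contains measure preservation). -/
def IsStationaryErgodic {Ω α : Type*} [MeasurableSpace Ω] [MeasurableSpace α]
    (μ : Measure Ω) (W : ℕ → Ω → α) : Prop :=
  Ergodic (shift (α := α)) (μ.map (fun ω i => W i ω))

/-- The word formed by the first `t` letters of the process. The letter of index `i` here is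
letter number `i + 1` in the numbering that starts from one. -/
def block {Ω α : Type*} (W : ℕ → Ω → α) (t : ℕ) (ω : Ω) : Fin t → α := fun i => W i ω

/-- The probability that the process begins with the word `u`. -/
noncomputable def wordProb {Ω α : Type*} [MeasurableSpace Ω]
    (μ : Measure Ω) (W : ℕ → Ω → α) {t : ℕ} (u : Fin t → α) : ℝ :=
  μ.real {ω | block W t ω = u}

/-- The Shannon entropy of order `m`, in bits per letter:
`-(1/(m+1)) ∑ P(u) log₂ P(u)` over all words `u` of length `m + 1`. -/
noncomputable def entropy {Ω α : Type*} [MeasurableSpace Ω] [Fintype α]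
    (μ : Measure Ω) (W : ℕ → Ω → α) (m : ℕ) : ℝ :=
  -(1 / ((m : ℝ) + 1)) *
    ∑ u : Fin (m + 1) → α, wordProb μ W u * Real.logb 2 (wordProb μ W u)

/-- The conditional entropy of order `m`: `h_m(X|Z) = h_m(X,Z) - h_m(Z)`. -/
noncomputable def condEntropy {Ω α β : Type*} [MeasurableSpace Ω] [Fintype α] [Fintype β]
    (μ : Measure Ω) (X : ℕ → Ω → α) (Z : ℕ → Ω → β) (m : ℕ) : ℝ :=
  entropy μ (fun i ω => (X i ω, Z i ω)) m - entropy μ Z m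

/-- The conditional entropy rate `h(X|Z) = lim h_m(X|Z)`. -/
noncomputable def condEntropyRate {Ω α β : Type*} [MeasurableSpace Ω] [Fintype α] [Fintype β]
    (μ : Measure Ω) (X : ℕ → Ω → α) (Z : ℕ → Ω → β) : ℝ :=
  limUnder atTop (condEntropy μ X Z)

/-- The conditional probability that the first `t` letters of `X` form a word of `S`, given that
the first `t` letters of `Z` form the word `z`. -/
noncomputable def condSetProb {Ω α β : Type*} [MeasurableSpace Ω]
    (μ : Measure Ω) (X : ℕ → Ω → α) (Z : ℕ → Ω → β) {t : ℕ}
    (S : Set (Fin t → α)) (z : Fin t → β) : ℝ :=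
  (μ[|{ω | block Z t ω = z}]).real {ω | block X t ω ∈ S}

/-- The conditional probability `P(x|z)` of the word `x` of `X` given the word `z` of `Z`. -/
noncomputable def condWordProb {Ω α β : Type*} [MeasurableSpace Ω]
    (μ : Measure Ω) (X : ℕ → Ω → α) (Z : ℕ → Ω → β) {t : ℕ}
    (x : Fin t → α) (z : Fin t → β) : ℝ :=
  condSetProb μ X Z {x} z

end RunningKey

open RunningKey

/-! The proof is a conditional form of the asymptotic equipartition property. The map `(x, y) ↦ (x,
c x y)` makes `(X, Z)` a letter-to-letter factor of `(X, Y)`, hence stationary and ergodic, and so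
is `Z`. Shannon–McMillan–Breiman (`exists_entropy_rate`) applies to both, and subtracting the two
limits through the chain rule gives `-(1/t) log P(X|Z) → h(X|Z)` almost surely. The sets `Ψ` consist
of words whose conditional information rate is close to this limit: closeness gives (ii), and a
counting bound turns their mass into cardinality, which gives (iii).

For (i), the plaintext being eventually typical is not enough: the conditional mass given each
ciphertext block must tend to one, while both the event and the conditioning change with `t`.
`ae_tendsto_fiberProb_of_eventually` handles this by bounding the events below by a fixed event of
probability near one and applying Lévy's upward theorem to it.

Shannon–McMillan–Breiman itself writes the information of a block as a sum along the orbit of the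
information of one letter given the letters that follow it; conditioning on the future keeps
everything on one-sided sequences. These terms converge by Lévy's theorem and are dominated by an
integrable function through a maximal inequality, so Maker's ergodic theorem, derived here from
Birkhoff's, gives the limit. -/

namespace RunningKey

/-! ### Birkhoff's ergodic theorem, by maximal sums. -/

section Birkhoff

variable {S : Type*} {T : S → S} {f : S → ℝ}

/-- The maximum of the Birkhoff sums of order `0, …, N`, defined through its recursion. -/
noncomputable def maxBirkhoffSum (T : S → S) (f : S → ℝ) : ℕ → S → ℝ
  | 0 => fun _ => 0
  | N + 1 => fun x => max 0 (f x + maxBirkhoffSum T f N (T x))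

lemma maxBirkhoffSum_nonneg (N : ℕ) (x : S) : 0 ≤ maxBirkhoffSum T f N x := by
  cases N with
  | zero => exact le_rfl
  | succ N => exact le_max_left _ _

lemma birkhoffSum_le_maxBirkhoffSum {n N : ℕ} (h : n ≤ N) (x : S) :
    birkhoffSum T f n x ≤ maxBirkhoffSum T f N x := by
  induction N generalizing n x with
  | zero => simp [Nat.le_zero.1 h, maxBirkhoffSum]
  | succ N ih =>
    cases n with
    | zero => simpa using maxBirkhoffSum_nonneg (N + 1) x
    | succ n =>
      rw [birkhoffSum_succ']
      exact (add_le_add_right (ih (Nat.le_of_succ_le_succ h) (T x)) _).trans (le_max_right _ _)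

lemma maxBirkhoffSum_le_succ (N : ℕ) (x : S) :
    maxBirkhoffSum T f N x ≤ maxBirkhoffSum T f (N + 1) x := by
  induction N generalizing x with
  | zero => exact maxBirkhoffSum_nonneg 1 x
  | succ N ih => exact max_le_max le_rfl (add_le_add_right (ih (T x)) _)

variable [MeasurableSpace S] {ν : Measure S}

lemma integrable_maxBirkhoffSum (hT : MeasurePreserving T ν ν) (hf : Integrable f ν) (N : ℕ) :
    Integrable (maxBirkhoffSum T f N) ν := by
  induction N with
  | zero => exact integrable_zero _ _ _
  | succ N ih =>
    exact (integrable_zero _ _ _).sup (hf.add (hT.integrable_comp_of_integrable ih))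

lemma integrable_birkhoffSum (hT : MeasurePreserving T ν ν) (hf : Integrable f ν) (n : ℕ) :
    Integrable (birkhoffSum T f n) ν := by
  unfold birkhoffSum
  exact integrable_finsetSum _ fun k _ => (hT.iterate k).integrable_comp_of_integrable hf

/-- If the Birkhoff sums are almost everywhere unbounded above, the integral is nonnegative. -/
lemma integral_nonneg_of_birkhoffSum_unbounded (hT : MeasurePreserving T ν ν)
    (hf : Integrable f ν)
    (h : ∀ᵐ x ∂ν, ¬ BddAbove (Set.range fun n => birkhoffSum T f n x)) : 0 ≤ ∫ x, f x ∂ν := by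
  have hM := integrable_maxBirkhoffSum hT hf
  have hMT := fun N => hT.integrable_comp_of_integrable (hM N)
  -- The integrand equals `f x` as soon as the maximal sum at `T x` exceeds `-f x`; maximal sums are
  -- nonnegative, so `|f|` dominates.
  have key : Tendsto (fun N => ∫ x, max (-(maxBirkhoffSum T f N (T x))) (f x) ∂ν) atTop
      (𝓝 (∫ x, f x ∂ν)) := by
    refine tendsto_integral_of_dominated_convergence (fun x => |f x|)
      (fun N => ((hMT N).neg.sup hf).aestronglyMeasurable) hf.abs ?_ ?_
    · intro N
      refine Eventually.of_forall fun x => ?_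
      have := maxBirkhoffSum_nonneg (T := T) (f := f) N (T x)
      rw [Real.norm_eq_abs]
      refine abs_le.2 ⟨(neg_abs_le _).trans (le_max_right _ _), max_le ?_ (le_abs_self _)⟩
      linarith [abs_nonneg (f x)]
    · have hTx : ∀ᵐ x ∂ν, ¬ BddAbove (Set.range fun n => birkhoffSum T f n (T x)) :=
        hT.quasiMeasurePreserving.ae h
      filter_upwards [hTx] with x hx
      refine tendsto_const_nhds.congr' ?_
      rw [not_bddAbove_iff] at hx
      obtain ⟨_, ⟨n, rfl⟩, hn⟩ := hx (-(f x))
      filter_upwards [eventually_ge_atTop n] with N hN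
      have := birkhoffSum_le_maxBirkhoffSum (T := T) (f := f) hN (T x)
      exact (max_eq_right (by linarith)).symm
  refine ge_of_tendsto' key fun N => ?_
  -- By this identity and invariance, the integral is that of an increment of the maximal sums,
  -- which is nonnegative.
  have hrec : ∀ x, max (-(maxBirkhoffSum T f N (T x))) (f x)
      = maxBirkhoffSum T f (N + 1) x - maxBirkhoffSum T f N (T x) := by
    intro x
    simp only [maxBirkhoffSum]
    rw [← max_sub_sub_right]
    congr 1 <;> ring
  have hcomp : ∫ x, maxBirkhoffSum T f N (T x) ∂ν = ∫ x, maxBirkhoffSum T f N x ∂ν := by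
    have := integral_map (μ := ν) hT.measurable.aemeasurable
      (f := maxBirkhoffSum T f N) (by rw [hT.map_eq]; exact (hM N).aestronglyMeasurable)
    rw [← this, hT.map_eq]
  simp_rw [hrec]
  have hMTN : Integrable (fun x => maxBirkhoffSum T f N (T x)) ν := hMT N
  rw [integral_sub (hM (N + 1)) hMTN, hcomp, sub_nonneg]
  exact integral_mono (hM N) (hM (N + 1)) fun x => maxBirkhoffSum_le_succ N x

/-- The Birkhoff sums of a function of negative integral are almost everywhere bounded above. -/
lemma ae_bddAbove_birkhoffSum (hT : Ergodic T ν) (hf : Integrable f ν)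
    (hneg : ∫ x, f x ∂ν < 0) :
    ∀ᵐ x ∂ν, BddAbove (Set.range fun n => birkhoffSum T f n x) := by
  set C : Set S := {x | ¬ BddAbove (Set.range fun n => birkhoffSum T f n x)} with hC
  have hCeq : C = ⋂ m : ℕ, ⋃ n : ℕ, {x | (m : ℝ) < birkhoffSum T f n x} := by
    ext x
    simp only [hC, Set.mem_ofPred_eq, not_bddAbove_iff, Set.exists_range_iff, Set.mem_iInter,
      Set.mem_iUnion]
    refine ⟨fun h m => h m, fun h r => ?_⟩
    obtain ⟨m, hm⟩ := exists_nat_gt r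
    obtain ⟨n, hn⟩ := h m
    exact ⟨n, hm.trans hn⟩
  have hCm : NullMeasurableSet C ν := by
    rw [hCeq]
    exact .iInter fun m => .iUnion fun n => nullMeasurableSet_lt aemeasurable_const
      (integrable_birkhoffSum hT.toMeasurePreserving hf n).aemeasurable
  have hinv : T ⁻¹' C = C := by
    ext x
    simp only [hC, Set.mem_preimage, Set.mem_ofPred_eq, not_iff_not]
    constructor
    · rintro ⟨b, hb⟩
      refine ⟨max 0 (f x + b), ?_⟩
      rintro _ ⟨n, rfl⟩
      cases n with
      | zero => simp
      | succ n =>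
        simp only [birkhoffSum_succ']
        exact le_max_of_le_right (add_le_add_right (hb ⟨n, rfl⟩) _)
    · rintro ⟨b, hb⟩
      refine ⟨b - f x, ?_⟩
      rintro _ ⟨n, rfl⟩
      have := hb ⟨n + 1, rfl⟩
      simp only [birkhoffSum_succ'] at this
      linarith
  rcases hT.quasiErgodic.ae_empty_or_univ₀ hCm hinv.eventuallyEq with h | h
  · filter_upwards [h] with x hx
    by_contra hcon
    exact (iff_of_eq hx).1 hcon
  · refine absurd (integral_nonneg_of_birkhoffSum_unbounded hT.toMeasurePreserving hf ?_)
      (not_le.2 hneg)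
    filter_upwards [h] with x hx
    exact (iff_of_eq hx).2 trivial

/-- For `s` strictly between the integral and `r`, the sums of `f - s` are bounded above, so
dividing by `n` leaves an average at most `s + o(1)`. -/
lemma ae_eventually_birkhoffAverage_lt [IsProbabilityMeasure ν] (hT : Ergodic T ν)
    (hf : Integrable f ν) {r : ℝ} (hr : ∫ x, f x ∂ν < r) :
    ∀ᵐ x ∂ν, ∀ᶠ n : ℕ in atTop, birkhoffAverage ℝ T f n x < r := by
  obtain ⟨s, hs, hsr⟩ := exists_between hr
  have hint : ∫ x, (f x - s) ∂ν < 0 := by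
    rw [integral_sub hf (integrable_const _)]
    simpa using hs
  filter_upwards [ae_bddAbove_birkhoffSum hT (hf.sub (integrable_const s)) hint] with x hx
  obtain ⟨b, hb⟩ := hx
  have hlim : Tendsto (fun n : ℕ => b / (n : ℝ)) atTop (𝓝 0) :=
    tendsto_const_div_atTop_nhds_zero_nat b
  filter_upwards [hlim.eventually (gt_mem_nhds (sub_pos.2 hsr)), eventually_gt_atTop 0]
    with n hn hn0
  have hn0' : (0 : ℝ) < n := by exact_mod_cast hn0
  have h1 : birkhoffSum T f n x - n * s ≤ b := by
    have := hb ⟨n, rfl⟩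
    simpa [birkhoffSum, Finset.sum_sub_distrib] using this
  rw [birkhoffAverage, smul_eq_mul, inv_mul_lt_iff₀ hn0']
  rw [div_lt_iff₀ hn0'] at hn
  linarith

/-- The pointwise ergodic theorem for ergodic transformations. -/
theorem ae_tendsto_birkhoffAverage [IsProbabilityMeasure ν] (hT : Ergodic T ν)
    (hf : Integrable f ν) :
    ∀ᵐ x ∂ν, Tendsto (fun n => birkhoffAverage ℝ T f n x) atTop (𝓝 (∫ y, f y ∂ν)) := by
  have hup : ∀ m : ℕ, ∀ᵐ x ∂ν, ∀ᶠ n : ℕ in atTop,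
      birkhoffAverage ℝ T f n x < ∫ y, f y ∂ν + 1 / ((m : ℝ) + 1) := fun m =>
    ae_eventually_birkhoffAverage_lt hT hf (lt_add_of_pos_right _ Nat.one_div_pos_of_nat)
  have hlow : ∀ m : ℕ, ∀ᵐ x ∂ν, ∀ᶠ n : ℕ in atTop,
      birkhoffAverage ℝ T (fun x => - f x) n x < -(∫ y, f y ∂ν) + 1 / ((m : ℝ) + 1) := fun m =>
    ae_eventually_birkhoffAverage_lt hT hf.neg
      (by rw [integral_neg']; exact lt_add_of_pos_right _ Nat.one_div_pos_of_nat)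
  filter_upwards [ae_all_iff.2 hup, ae_all_iff.2 hlow] with x h1 h2
  rw [Metric.tendsto_nhds]
  intro ε hε
  obtain ⟨m, hm⟩ := exists_nat_one_div_lt hε
  filter_upwards [h1 m, h2 m] with n hn1 hn2
  have hneg : birkhoffAverage ℝ T (fun x => - f x) n x = -birkhoffAverage ℝ T f n x := by
    simp [birkhoffAverage, birkhoffSum]
  rw [hneg] at hn2
  rw [Real.dist_eq, abs_lt]
  constructor <;> linarith

end Birkhoff

/-! ### Maker's ergodic theorem. -/

section Maker

variable {S : Type*} {T : S → S}

/-- Splitting off the last `N` terms of a sum along an orbit. -/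
lemma sum_le_birkhoffSum_add {D : ℕ → S → ℝ} {H H₀ : S → ℝ} {x : S} {N : ℕ}
    (hH : ∀ i k, D (N + k) (T^[i] x) ≤ H (T^[i] x)) (hH₀ : ∀ i k, D k (T^[i] x) ≤ H₀ (T^[i] x))
    (m : ℕ) :
    ∑ i ∈ Finset.range (m + N), D (m + N - 1 - i) (T^[i] x) ≤
      birkhoffSum T H m x + (birkhoffSum T H₀ (m + N) x - birkhoffSum T H₀ m x) := by
  rw [Finset.sum_range_add, birkhoffSum, birkhoffSum, birkhoffSum, Finset.sum_range_add,
    add_sub_cancel_left]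
  refine add_le_add (Finset.sum_le_sum fun i hi => ?_) (Finset.sum_le_sum fun i _ => hH₀ _ _)
  have := Finset.mem_range.1 hi
  have h := hH i (m - 1 - i)
  rwa [show N + (m - 1 - i) = m + N - 1 - i by omega] at h

variable [MeasurableSpace S] {ν : Measure S}

/-- Tail suprema of an a.e. null, integrably dominated sequence tend to zero in mean. -/
lemma tendsto_integral_iSup_tail {D : ℕ → S → ℝ} {G : S → ℝ} (hG : Integrable G ν)
    (hD : ∀ k, AEMeasurable (D k) ν) (hD0 : ∀ k x, 0 ≤ D k x)
    (hDG : ∀ᵐ x ∂ν, ∀ k, D k x ≤ G x) (hlim : ∀ᵐ x ∂ν, Tendsto (fun k => D k x) atTop (𝓝 0)) :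
    (∀ N, Integrable (fun x => ⨆ k, D (N + k) x) ν) ∧
      Tendsto (fun N => ∫ x, ⨆ k, D (N + k) x ∂ν) atTop (𝓝 0) := by
  have hmeas : ∀ N, AEStronglyMeasurable (fun x => ⨆ k, D (N + k) x) ν := fun N =>
    (AEMeasurable.iSup fun k => hD (N + k)).aestronglyMeasurable
  have hbound : ∀ N, ∀ᵐ x ∂ν, ‖⨆ k, D (N + k) x‖ ≤ G x := by
    intro N
    filter_upwards [hDG] with x hx
    rw [Real.norm_of_nonneg (Real.iSup_nonneg fun k => hD0 _ x)]
    exact ciSup_le fun k => hx _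
  refine ⟨fun N => hG.mono' (hmeas N) (hbound N), ?_⟩
  have := tendsto_integral_of_dominated_convergence (f := fun _ => (0 : ℝ)) G hmeas hG hbound ?_
  · simpa using this
  filter_upwards [hlim] with x hx
  rw [Metric.tendsto_atTop] at hx ⊢
  intro ε hε
  obtain ⟨N, hN⟩ := hx (ε / 2) (half_pos hε)
  refine ⟨N, fun n hn => ?_⟩
  rw [dist_zero_right, Real.norm_of_nonneg (Real.iSup_nonneg fun k => hD0 _ x)]
  refine lt_of_le_of_lt (ciSup_le fun k => ?_) (half_lt_self hε)
  have := hN (n + k) (by omega)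
  rw [dist_zero_right, Real.norm_eq_abs] at this
  exact (le_abs_self _).trans this.le

/-- Maker's generalization of the pointwise ergodic theorem. -/
theorem ae_tendsto_average_of_dominated [IsProbabilityMeasure ν] (hT : Ergodic T ν)
    {g : ℕ → S → ℝ} {g' G : S → ℝ} (hG : Integrable G ν) (hg : ∀ k, AEMeasurable (g k) ν)
    (hgG : ∀ᵐ x ∂ν, ∀ k, |g k x| ≤ G x)
    (hlim : ∀ᵐ x ∂ν, Tendsto (fun k => g k x) atTop (𝓝 (g' x))) :
    ∀ᵐ x ∂ν, Tendsto (fun n : ℕ => (n : ℝ)⁻¹ * ∑ i ∈ Finset.range n, g (n - 1 - i) (T^[i] x)) atTop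
      (𝓝 (∫ y, g' y ∂ν)) := by
  have hg'm : AEMeasurable g' ν := aemeasurable_of_tendsto_metrizable_ae atTop hg hlim
  have hg'G : ∀ᵐ x ∂ν, |g' x| ≤ G x := by
    filter_upwards [hgG, hlim] with x h1 h2
    exact le_of_tendsto h2.abs (Eventually.of_forall h1)
  have hg' : Integrable g' ν := hG.mono' hg'm.aestronglyMeasurable hg'G
  set D : ℕ → S → ℝ := fun k x => |g k x - g' x| with hDdef
  have hDG : ∀ᵐ x ∂ν, ∀ k, D k x ≤ 2 * G x := by
    filter_upwards [hgG, hg'G] with x h1 h2 k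
    have := abs_sub (g k x) (g' x)
    have := h1 k
    simp only [hDdef]
    linarith
  obtain ⟨hint, hH⟩ := tendsto_integral_iSup_tail (D := D) (hG.const_mul 2)
    (fun k => ((hg k).sub hg'm).abs) (fun k x => abs_nonneg _) hDG (by
      filter_upwards [hlim] with x hx
      simpa using (hx.sub_const (g' x)).abs)
  set H : ℕ → S → ℝ := fun N x => ⨆ k, D (N + k) x with hHdef
  have hHle : ∀ᵐ x ∂ν, ∀ N k, D (N + k) x ≤ H N x := by
    filter_upwards [hDG] with x hx N k
    exact le_ciSup (f := fun k => D (N + k) x) ⟨2 * G x, by rintro _ ⟨j, rfl⟩; exact hx _⟩ k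
  have horb : ∀ᵐ x ∂ν, ∀ i N k, D (N + k) (T^[i] x) ≤ H N (T^[i] x) :=
    ae_all_iff.2 fun i => (hT.toMeasurePreserving.iterate i).quasiMeasurePreserving.ae hHle
  have hB := ae_all_iff.2 fun N => ae_tendsto_birkhoffAverage hT (hint N)
  filter_upwards [horb, hB, ae_tendsto_birkhoffAverage hT hg'] with x hx hxB hxg
  have herr : Tendsto (fun n : ℕ => (n : ℝ)⁻¹ * ∑ i ∈ Finset.range n, D (n - 1 - i) (T^[i] x)) atTop
      (𝓝 0) := by
    rw [tendsto_order]
    refine ⟨fun a ha => Eventually.of_forall fun n => ha.trans_le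
      (mul_nonneg (by positivity) (Finset.sum_nonneg fun i _ => abs_nonneg _)), fun a ha => ?_⟩
    -- With `n = m + N`, the first `m` terms have index at least `N` and are controlled by `H N`, of
    -- mean below `a`; the last `N` terms are controlled by `H 0` and vanish after division by `n`.
    obtain ⟨N, hN⟩ := (hH.eventually (gt_mem_nhds ha)).exists
    rw [← map_add_atTop_eq_nat N]
    refine Filter.eventually_map.2 ?_
    have hratio : Tendsto (fun m : ℕ => (m : ℝ) / ((m + N : ℕ) : ℝ)) atTop (𝓝 1) := by
      have := tendsto_natCast_div_add_atTop (𝕜 := ℝ) (N : ℝ)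
      simpa using this
    have hb : Tendsto (fun m : ℕ => (m : ℝ) / ((m + N : ℕ) : ℝ) * birkhoffAverage ℝ T (H N) m x +
        (birkhoffAverage ℝ T (H 0) (m + N) x -
          (m : ℝ) / ((m + N : ℕ) : ℝ) * birkhoffAverage ℝ T (H 0) m x)) atTop
        (𝓝 (1 * (∫ y, H N y ∂ν) + ((∫ y, H 0 y ∂ν) - 1 * (∫ y, H 0 y ∂ν)))) :=
      (hratio.mul (hxB N)).add
        ((((tendsto_add_atTop_iff_nat N).2 (hxB 0))).sub (hratio.mul (hxB 0)))
    rw [one_mul, one_mul, sub_self, add_zero] at hb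
    filter_upwards [hb.eventually (gt_mem_nhds hN), eventually_gt_atTop 0] with m hm hm0
    refine lt_of_le_of_lt ?_ hm
    have hm0' : (0 : ℝ) < m := by exact_mod_cast hm0
    have hmN : (0 : ℝ) < ((m + N : ℕ) : ℝ) := by positivity
    have hs := sum_le_birkhoffSum_add (D := D) (H := H N) (H₀ := H 0) (fun i k => hx i N k)
      (fun i k => by simpa using hx i 0 k) m
    calc _ ≤ ((m + N : ℕ) : ℝ)⁻¹ * (birkhoffSum T (H N) m x +
          (birkhoffSum T (H 0) (m + N) x - birkhoffSum T (H 0) m x)) := by gcongr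
      _ = _ := by
        simp only [birkhoffAverage, smul_eq_mul]
        field_simp
  have hsub : Tendsto (fun n : ℕ => (n : ℝ)⁻¹ * ∑ i ∈ Finset.range n, g (n - 1 - i) (T^[i] x) -
      birkhoffAverage ℝ T g' n x) atTop (𝓝 0) := by
    refine squeeze_zero_norm (fun n => ?_) herr
    rw [birkhoffAverage, smul_eq_mul, ← mul_sub, birkhoffSum, ← Finset.sum_sub_distrib, norm_mul,
      Real.norm_of_nonneg (by positivity : (0 : ℝ) ≤ (n : ℝ)⁻¹)]
    gcongr
    exact norm_sum_le _ _
  simpa using hsub.add hxg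

end Maker

/-! ### Conditional probability given a variable with finitely many values. -/

section CondProb

variable {Ω β : Type*} [mΩ : MeasurableSpace Ω] {μ : Measure Ω} {U : Ω → β} {E : Set Ω}

/-- The conditional probability of the event `E` given the value of `U`. -/
noncomputable def fiberProb (μ : Measure Ω) (U : Ω → β) (E : Set Ω) (ω : Ω) : ℝ :=
  (μ[|{ω' | U ω' = U ω}]).real E

lemma fiberProb_nonneg (ω : Ω) : 0 ≤ fiberProb μ U E ω := measureReal_nonneg

lemma fiberProb_le_one (ω : Ω) : fiberProb μ U E ω ≤ 1 := measureReal_le_one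

lemma ae_fiber_pos [IsFiniteMeasure μ] [Finite β] (U : Ω → β) :
    ∀ᵐ ω ∂μ, 0 < μ.real {ω' | U ω' = U ω} := by
  have h : ∀ b, ∀ᵐ ω ∂μ, U ω = b → 0 < μ.real {ω' | U ω' = b} := by
    intro b
    rcases eq_or_ne (μ {ω' | U ω' = b}) 0 with h0 | h0
    · have : ∀ᵐ ω ∂μ, ω ∉ {ω' | U ω' = b} := measure_eq_zero_iff_ae_notMem.1 h0
      filter_upwards [this] with ω h1 h2
      exact absurd h2 h1
    · exact Eventually.of_forall fun _ _ => ENNReal.toReal_pos h0 (measure_ne_top _ _)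
  filter_upwards [ae_all_iff.2 h] with ω hω using hω _ rfl

variable [MeasurableSpace β] [MeasurableSingletonClass β]

lemma cond_real_mul_eq [IsFiniteMeasure μ] (hU : Measurable U) (b : β) :
    μ.real {ω | U ω = b} * (μ[|{ω | U ω = b}]).real E = μ.real ({ω | U ω = b} ∩ E) := by
  have hms : MeasurableSet {ω | U ω = b} := hU (measurableSet_singleton b)
  rw [measureReal_def, measureReal_def, measureReal_def, ← ENNReal.toReal_mul, mul_comm,
    cond_mul_eq_inter hms]

variable [Fintype β]

lemma measurable_fiberProb : Measurable[MeasurableSpace.comap U inferInstance]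
    (fiberProb μ U E) :=
  (measurable_of_finite (fun b => (μ[|{ω' | U ω' = b}]).real E)).comp (comap_measurable U)

variable [IsProbabilityMeasure μ]

lemma setIntegral_fiberProb (hU : Measurable U) (hE : MeasurableSet E) (B : Set β) :
    ∫ ω in U ⁻¹' B, fiberProb μ U E ω ∂μ = μ.real (U ⁻¹' B ∩ E) := by
  classical
  have hms : ∀ b, MeasurableSet {ω | U ω = b} := fun b => hU (measurableSet_singleton b)
  have hdec : U ⁻¹' B = ⋃ b ∈ B.toFinite.toFinset, {ω | U ω = b} := by ext; simp
  have hdis : Set.PairwiseDisjoint (↑B.toFinite.toFinset : Set β) fun b => {ω | U ω = b} := by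
    intro a _ b _ hab
    exact Set.disjoint_left.2 fun ω h1 h2 => hab (h1.symm.trans h2)
  have hint : Integrable (fiberProb μ U E) μ :=
    Integrable.of_bound (measurable_fiberProb.mono hU.comap_le le_rfl).aestronglyMeasurable 1
      (Eventually.of_forall fun ω => by
        rw [Real.norm_of_nonneg (fiberProb_nonneg ω)]; exact fiberProb_le_one ω)
  rw [hdec, integral_biUnion_finset _ (fun b _ => hms b) hdis (fun b _ => hint.integrableOn),
    Set.iUnion₂_inter, measureReal_biUnion_finset (hdis.mono fun b => Set.inter_subset_left)
      (fun b _ => (hms b).inter hE)]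
  refine Finset.sum_congr rfl fun b _ => ?_
  rw [setIntegral_congr_fun (g := fun _ => (μ[|{ω | U ω = b}]).real E) (hms b) (fun ω hω => by
      simp only [fiberProb, show U ω = b from hω]), setIntegral_const, smul_eq_mul,
    cond_real_mul_eq hU]

/-- Connects elementary conditional probabilities with martingale convergence. -/
lemma fiberProb_ae_eq_condExp (hU : Measurable U) (hE : MeasurableSet E) :
    fiberProb μ U E =ᵐ[μ]
      μ[E.indicator (fun _ => (1 : ℝ)) | MeasurableSpace.comap U inferInstance] := by
  have hint : Integrable (fiberProb μ U E) μ :=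
    Integrable.of_bound (measurable_fiberProb.mono hU.comap_le le_rfl).aestronglyMeasurable 1
      (Eventually.of_forall fun ω => by
        rw [Real.norm_of_nonneg (fiberProb_nonneg ω)]; exact fiberProb_le_one ω)
  refine ae_eq_condExp_of_forall_setIntegral_eq hU.comap_le
    ((integrable_const _).indicator hE) (fun _ _ _ => hint.integrableOn) ?_
    measurable_fiberProb.stronglyMeasurable.aestronglyMeasurable
  rintro _ ⟨B, hB, rfl⟩ _
  rw [setIntegral_fiberProb hU hE, setIntegral_indicator hE, setIntegral_const]
  simp

end CondProb

/-! ### Conditional probabilities of increasing events. -/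

section Exhaustion

/-- Markov's inequality for `1 - V N`: where every `V N` is at most `r`, the loss is at least `1 -
r`, yet its mean `1 - μ (B N)` tends to zero. -/
lemma ae_exists_lt_condExp {Ω : Type*} {m mΩ : MeasurableSpace Ω} {μ : Measure Ω}
    [IsProbabilityMeasure μ] (hm : m ≤ mΩ) {B : ℕ → Set Ω} (hBm : ∀ N, MeasurableSet (B N))
    (hBmono : Monotone B) (hBU : ∀ᵐ ω ∂μ, ω ∈ ⋃ N, B N) {r : ℝ} (hr : r < 1) :
    ∀ᵐ ω ∂μ, ∃ N, r < (μ[(B N).indicator (fun _ => (1 : ℝ)) | m]) ω := by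
  set V : ℕ → Ω → ℝ := fun N => μ[(B N).indicator (fun _ => (1 : ℝ)) | m] with hV
  have hBint : ∀ N, Integrable ((B N).indicator (fun _ => (1 : ℝ))) μ := fun N =>
    (integrable_const _).indicator (hBm N)
  have hVint : ∀ N, ∫ ω, V N ω ∂μ = μ.real (B N) := by
    intro N
    rw [hV, integral_condExp hm, integral_indicator_const _ (hBm N)]
    simp
  have hV1 : ∀ N, V N ≤ᵐ[μ] fun _ => 1 := by
    intro N
    have := condExp_mono (m := m) (hBint N) (integrable_const (1 : ℝ))
      (Eventually.of_forall fun ω => Set.indicator_le_self' (fun _ _ => zero_le_one) ω)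
    rwa [condExp_const hm] at this
  have hBlim : Tendsto (fun N => 1 - μ.real (B N)) atTop (𝓝 0) := by
    have h2 := tendsto_measure_iUnion_atTop (μ := μ) hBmono
    rw [(mem_ae_iff_prob_eq_one (MeasurableSet.iUnion hBm)).1 hBU] at h2
    have h3 := (ENNReal.tendsto_toReal ENNReal.one_ne_top).comp h2
    have h4 := (tendsto_const_nhds (x := (1 : ℝ))).sub h3
    rwa [ENNReal.toReal_one, sub_self] at h4
  have hr' : 0 < 1 - r := sub_pos.2 hr
  rw [ae_iff]
  set D : Set Ω := {ω | ¬ ∃ N, r < V N ω}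
  have hle : ∀ N, (1 - r) * μ.real D ≤ 1 - μ.real (B N) := by
    intro N
    have h1 := mul_meas_ge_le_integral_of_nonneg (μ := μ) (f := fun ω => 1 - V N ω)
      (by filter_upwards [hV1 N] with ω hω using sub_nonneg.2 hω)
      ((integrable_const _).sub integrable_condExp) (1 - r)
    rw [integral_sub (integrable_const _) integrable_condExp, hVint] at h1
    simp only [integral_const, probReal_univ, smul_eq_mul, mul_one] at h1
    refine le_trans (mul_le_mul_of_nonneg_left (measureReal_mono fun ω hω => ?_) hr'.le) h1
    have := not_lt.1 (not_exists.1 hω N)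
    exact sub_le_sub_left this 1
  have h0 : (1 - r) * μ.real D ≤ 0 := ge_of_tendsto' hBlim hle
  have : μ.real D = 0 := le_antisymm (by nlinarith) measureReal_nonneg
  exact (measureReal_eq_zero_iff).1 this

end Exhaustion

/-! ### Lévy's upward theorem along blocks. -/

section BlockFiltration

variable {Ω α : Type*} [MeasurableSpace α] {W : ℕ → Ω → α}

lemma comap_block_mono {s t : ℕ} (hst : s ≤ t) :
    MeasurableSpace.comap (block W s) inferInstance ≤
      MeasurableSpace.comap (block W t) inferInstance := by
  have : block W s = (fun (u : Fin t → α) (i : Fin s) => u (Fin.castLE hst i)) ∘ block W t := rfl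
  rw [this, ← MeasurableSpace.comap_comp]
  exact MeasurableSpace.comap_mono
    (Measurable.comap_le (measurable_pi_lambda _ fun i => measurable_pi_apply _))

variable [mΩ : MeasurableSpace Ω]

lemma measurable_block (hW : ∀ i, Measurable (W i)) (t : ℕ) : Measurable (block W t) :=
  measurable_pi_lambda _ fun i => hW i

/-- The filtration generated by the successive letters of a process. -/
def blockFiltration (hW : ∀ i, Measurable (W i)) : Filtration ℕ mΩ where
  seq t := MeasurableSpace.comap (block W t) inferInstance
  mono' _ _ h := comap_block_mono h
  le' t := (measurable_block hW t).comap_le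

variable {μ : Measure Ω} [IsProbabilityMeasure μ] [Fintype α] [MeasurableSingletonClass α]

lemma ae_tendsto_fiberProb_block (hW : ∀ i, Measurable (W i)) {E : Set Ω} (hE : MeasurableSet E) :
    ∀ᵐ ω ∂μ, Tendsto (fun t => fiberProb μ (block W t) E ω) atTop
      (𝓝 ((μ[E.indicator (fun _ => (1 : ℝ)) | ⨆ t, blockFiltration hW t]) ω)) := by
  have h1 := tendsto_ae_condExp (μ := μ) (ℱ := blockFiltration hW) (E.indicator fun _ => (1 : ℝ))
  have h2 := ae_all_iff.2 fun t =>
    fiberProb_ae_eq_condExp (μ := μ) (measurable_block hW t) hE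
  filter_upwards [h1, h2] with ω h3 h4
  exact h3.congr fun t => (h4 t).symm

/-- If events `E t` eventually occur almost surely, then their conditional probabilities given
the growing blocks of a process tend to one almost surely. -/
theorem ae_tendsto_fiberProb_of_eventually (hW : ∀ i, Measurable (W i)) {E : ℕ → Set Ω}
    (hE : ∀ t, MeasurableSet (E t)) (hev : ∀ᵐ ω ∂μ, ∀ᶠ t in atTop, ω ∈ E t) :
    ∀ᵐ ω ∂μ, Tendsto (fun t => fiberProb μ (block W t) (E t) ω) atTop (𝓝 1) := by
  -- For fixed `N`, `B N ⊆ E t` once `t ≥ N`, so Lévy's theorem for the fixed event `B N` bounds the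
  -- moving probabilities from below.
  set B : ℕ → Set Ω := fun N => ⋂ t ≥ N, E t with hB
  have hBm : ∀ N, MeasurableSet (B N) := fun N =>
    MeasurableSet.iInter fun t => MeasurableSet.iInter fun _ => hE t
  have hBmono : Monotone B := fun M N hMN =>
    Set.biInter_mono (fun t ht => le_trans hMN ht) fun _ _ => subset_rfl
  have hBU : ∀ᵐ ω ∂μ, ω ∈ ⋃ N, B N := by
    filter_upwards [hev] with ω hω
    obtain ⟨N, hN⟩ := eventually_atTop.1 hω
    exact Set.mem_iUnion.2 ⟨N, Set.mem_iInter₂.2 hN⟩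
  have hkey := ae_all_iff.2 fun j : ℕ => ae_exists_lt_condExp
    (iSup_le fun t => (blockFiltration hW).le t) hBm hBmono hBU
    (sub_lt_self 1 (Nat.one_div_pos_of_nat (n := j) (α := ℝ)))
  have hconv := ae_all_iff.2 fun N => ae_tendsto_fiberProb_block (μ := μ) hW (hBm N)
  filter_upwards [hkey, hconv] with ω h1 h2
  rw [tendsto_order]
  refine ⟨fun a ha => ?_,
    fun a ha => Eventually.of_forall fun t => (fiberProb_le_one ω).trans_lt ha⟩
  obtain ⟨j, hj⟩ := exists_nat_one_div_lt (sub_pos.2 ha)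
  obtain ⟨N, hN⟩ := h1 j
  filter_upwards [(h2 N).eventually (lt_mem_nhds (lt_trans (lt_sub_comm.1 hj) hN)),
    eventually_ge_atTop N] with t ht htN
  exact ht.trans_le (measureReal_mono (Set.biInter_subset_of_mem htN))

end BlockFiltration

/-! ### Maximal inequality and integrability from exponential tails. -/

section Maximal

variable {Ω α : Type*} [mΩ : MeasurableSpace Ω] {μ : Measure Ω} [IsProbabilityMeasure μ]
  [Fintype α] [MeasurableSpace α] [MeasurableSingletonClass α] {W : ℕ → Ω → α}

/-- A maximal inequality: an event is unlikely to occur while its conditional probability given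
some block of a process is small. -/
lemma measure_inter_exists_fiberProb_lt_le (hW : ∀ i, Measurable (W i)) {E : Set Ω}
    (hE : MeasurableSet E) (c : ℝ) :
    μ (E ∩ {ω | ∃ k, fiberProb μ (block W k) E ω < c}) ≤ ENNReal.ofReal c := by
  -- `D k` says that `k` is the first time below `c`. It is determined by the `k`-block, so `μ (D k
  -- ∩ E)` is the integral of the conditional probability over `D k`, at most `c * μ (D k)`.
  set D : ℕ → Set Ω := fun k => {ω | fiberProb μ (block W k) E ω < c} ∩
    ⋂ j < k, {ω | c ≤ fiberProb μ (block W j) E ω} with hD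
  have hDF : ∀ k, MeasurableSet[MeasurableSpace.comap (block W k) inferInstance] (D k) := by
    intro k
    refine MeasurableSet.inter ?_ (MeasurableSet.iInter fun j => MeasurableSet.iInter fun hj => ?_)
    · exact measurable_fiberProb measurableSet_Iio
    · exact (measurable_fiberProb.mono (comap_block_mono hj.le) le_rfl) measurableSet_Ici
  have hDm : ∀ k, MeasurableSet (D k) := fun k => (measurable_block hW k).comap_le _ (hDF k)
  have hdis : Pairwise (Function.onFun Disjoint D) := by
    have : ∀ i j, i < j → Disjoint (D i) (D j) := fun i j hij =>
      Set.disjoint_left.2 fun ω h1 h2 =>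
        not_le.2 (show fiberProb μ (block W i) E ω < c from h1.1) (Set.mem_iInter₂.1 h2.2 i hij)
    intro i j hij
    rcases lt_or_gt_of_ne hij with h | h
    · exact this i j h
    · exact (this j i h).symm
  have hcover : E ∩ {ω | ∃ k, fiberProb μ (block W k) E ω < c} ⊆ ⋃ k, D k ∩ E := by
    classical
    rintro ω ⟨hωE, hω⟩
    refine Set.mem_iUnion.2 ⟨Nat.find hω, ⟨Nat.find_spec hω, ?_⟩, hωE⟩
    exact Set.mem_iInter₂.2 fun j hj => not_lt.1 (Nat.find_min hω hj)
  have hk : ∀ k, μ (D k ∩ E) ≤ ENNReal.ofReal c * μ (D k) := by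
    intro k
    obtain ⟨B, -, hB⟩ := hDF k
    have h1 := setIntegral_fiberProb (μ := μ) (measurable_block hW k) hE B
    rw [hB] at h1
    have hint : Integrable (fiberProb μ (block W k) E) μ := by
      refine Integrable.of_bound (measurable_fiberProb.mono (measurable_block hW k).comap_le
        le_rfl).aestronglyMeasurable 1 (Eventually.of_forall fun ω => ?_)
      rw [Real.norm_of_nonneg (fiberProb_nonneg ω)]
      exact fiberProb_le_one ω
    have h2 : ∫ ω in D k, fiberProb μ (block W k) E ω ∂μ ≤ ∫ _ in D k, c ∂μ :=
      setIntegral_mono_on hint.integrableOn (integrable_const c) (hDm k)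
        fun ω hω => (show fiberProb μ (block W k) E ω < c from hω.1).le
    rw [h1, setIntegral_const, smul_eq_mul] at h2
    rw [← ofReal_measureReal (measure_ne_top μ (D k)), ← ofReal_measureReal (measure_ne_top μ _),
      mul_comm, ← ENNReal.ofReal_mul measureReal_nonneg]
    exact ENNReal.ofReal_le_ofReal h2
  calc μ (E ∩ {ω | ∃ k, fiberProb μ (block W k) E ω < c}) ≤ μ (⋃ k, D k ∩ E) :=
        measure_mono hcover
    _ ≤ ∑' k, μ (D k ∩ E) := measure_iUnion_le _
    _ ≤ ∑' k, ENNReal.ofReal c * μ (D k) := ENNReal.tsum_le_tsum hk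
    _ = ENNReal.ofReal c * μ (⋃ k, D k) := by
      rw [ENNReal.tsum_mul_left, measure_iUnion hdis hDm]
    _ ≤ ENNReal.ofReal c * 1 := by gcongr; exact prob_le_one
    _ = ENNReal.ofReal c := mul_one _

end Maximal

/-- The sum counts the naturals below `a`, of which there are at least `a`; this is the discrete
layer-cake bound. -/
lemma le_tsum_indicator_natCast_lt (a : ENNReal) :
    a ≤ ∑' j : ℕ, Set.indicator {j : ℕ | (j : ENNReal) < a} (fun _ => (1 : ENNReal)) j := by
  refine ENNReal.le_of_forall_nnreal_lt fun r hr => ?_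
  calc (r : ENNReal) ≤ ((⌈r⌉₊ : NNReal) : ENNReal) := by exact_mod_cast Nat.le_ceil r
    _ = ∑ j ∈ Finset.range ⌈r⌉₊,
        Set.indicator {j : ℕ | (j : ENNReal) < a} (fun _ => (1 : ENNReal)) j := by
      rw [Finset.sum_congr rfl (g := fun _ => 1)]
      · simp
      · intro j hj
        refine Set.indicator_of_mem ?_ _
        have : (j : NNReal) < r := Nat.lt_ceil.1 (Finset.mem_range.1 hj)
        exact lt_trans (by exact_mod_cast this) hr
    _ ≤ _ := ENNReal.sum_le_tsum _

/-- A nonnegative function with exponentially small tails has a finite integral. -/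
lemma lintegral_ne_top_of_exp_tail {Ω : Type*} [MeasurableSpace Ω] {μ : Measure Ω}
    {F : Ω → ENNReal} (hF : Measurable F) (K : ℕ)
    (htail : ∀ j : ℕ, μ {ω | (j : ENNReal) < F ω} ≤ K * ENNReal.ofReal (Real.exp (-j))) :
    ∫⁻ ω, F ω ∂μ ≠ ⊤ := by
  have hms : ∀ j : ℕ, MeasurableSet {ω | (j : ENNReal) < F ω} := fun j =>
    measurableSet_lt measurable_const hF
  have hle : ∫⁻ ω, F ω ∂μ ≤ ∑' j : ℕ, K * ENNReal.ofReal (Real.exp (-j)) := by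
    calc ∫⁻ ω, F ω ∂μ ≤ ∫⁻ ω, ∑' j : ℕ,
          Set.indicator {ω | (j : ENNReal) < F ω} (fun _ => (1 : ENNReal)) ω ∂μ :=
          lintegral_mono fun ω => le_tsum_indicator_natCast_lt (F ω)
      _ = ∑' j : ℕ, μ {ω | (j : ENNReal) < F ω} := by
        rw [lintegral_tsum fun j => (measurable_const.indicator (hms j)).aemeasurable]
        exact tsum_congr fun j => lintegral_indicator_one (hms j)
      _ ≤ _ := ENNReal.tsum_le_tsum htail
  refine ne_top_of_le_ne_top ?_ hle
  rw [ENNReal.tsum_mul_left]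
  exact ENNReal.mul_ne_top (ENNReal.natCast_ne_top K) Real.summable_exp_neg_nat.tsum_ofReal_ne_top

/-! ### Shannon–McMillan–Breiman on sequence space. -/

section PathSpace

variable {α : Type*} [MeasurableSpace α] {ν : Measure (ℕ → α)}

/-- The information content, in nats, of the first `k` letters of the sequence `x`. -/
noncomputable def information (ν : Measure (ℕ → α)) (k : ℕ) (x : ℕ → α) : ℝ :=
  -Real.log (ν.real {y | block (fun i (y : ℕ → α) => y i) k y = block (fun i y => y i) k x})

/-- The information content of the initial letter of `x` given the following `k` letters. -/
noncomputable def informationIncr (ν : Measure (ℕ → α)) (k : ℕ) (x : ℕ → α) : ℝ :=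
  information ν (k + 1) x - information ν k (shift x)

/-- Telescoping puts the information of a block into the form required by Maker's theorem. -/
lemma sum_informationIncr [IsProbabilityMeasure ν] (n : ℕ) (x : ℕ → α) :
    ∑ i ∈ Finset.range n, informationIncr ν (n - 1 - i) (shift^[i] x) = information ν n x := by
  have h : ∀ i ∈ Finset.range n, informationIncr ν (n - 1 - i) (shift^[i] x) =
      information ν (n - i) (shift^[i] x) - information ν (n - (i + 1)) (shift^[i + 1] x) := by
    intro i hi
    have := Finset.mem_range.1 hi
    rw [informationIncr, show n - 1 - i + 1 = n - i by omega, show n - 1 - i = n - (i + 1) by omega,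
      Function.iterate_succ_apply']
  rw [Finset.sum_congr rfl h,
    Finset.sum_range_sub' (fun i => information ν (n - i) (shift^[i] x)) n]
  have h0 : ∀ y, information ν 0 y = 0 := by
    intro y
    have : {y' : ℕ → α | block (fun i (y : ℕ → α) => y i) 0 y' = block (fun i y => y i) 0 y}
        = Set.univ := Set.eq_univ_of_forall fun _ => Subsingleton.elim _ _
    rw [information, this, probReal_univ, Real.log_one, neg_zero]
  simp [h0]

lemma measurable_shift : Measurable (shift (α := α)) :=
  measurable_pi_lambda _ fun i => measurable_pi_apply (i + 1)

lemma measurableSet_initial_eq [MeasurableSingletonClass α] (a : α) :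
    MeasurableSet {y : ℕ → α | y 0 = a} := by
  have h : Measurable fun y : ℕ → α => y 0 := measurable_pi_apply 0
  exact h (measurableSet_singleton a)

variable [Fintype α] [MeasurableSingletonClass α]

lemma measurable_information (k : ℕ) : Measurable (information ν k) :=
  (measurable_of_finite (fun u : Fin k → α =>
    -Real.log (ν.real {y | block (fun i (y : ℕ → α) => y i) k y = u}))).comp
    (measurable_block (fun i => measurable_pi_apply i) k)

lemma measurable_informationIncr (k : ℕ) : Measurable (informationIncr ν k) :=
  (measurable_information (k + 1)).sub ((measurable_information k).comp measurable_shift)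

variable [IsProbabilityMeasure ν]

/-- Stationarity equates the probability of the shifted block with that of letters `1, …, k`, so the
increment is a genuine conditional information. Positivity of the blocks excludes the default value
of `Real.log` at zero. -/
lemma ae_exp_neg_informationIncr (hT : MeasurePreserving shift ν ν) :
    ∀ᵐ x ∂ν, ∀ k, Real.exp (-informationIncr ν k x) =
      fiberProb ν (block (fun i (y : ℕ → α) => y (i + 1)) k) {y | y 0 = x 0} x := by
  have hpos := ae_all_iff.2 fun k => ae_fiber_pos (μ := ν) (block (fun i (y : ℕ → α) => y i) k)
  filter_upwards [hpos, hT.quasiMeasurePreserving.ae hpos] with x hx hTx k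
  have hU : Measurable (block (fun i (y : ℕ → α) => y (i + 1)) k) :=
    measurable_block (fun i => measurable_pi_apply (i + 1)) k
  have hmul := cond_real_mul_eq (μ := ν) (E := {y | y 0 = x 0}) hU
    (block (fun i (y : ℕ → α) => y (i + 1)) k x)
  have hinter : {y : ℕ → α | block (fun i (y : ℕ → α) => y (i + 1)) k y =
      block (fun i (y : ℕ → α) => y (i + 1)) k x} ∩ {y | y 0 = x 0} =
      {y | block (fun i (y : ℕ → α) => y i) (k + 1) y = block (fun i y => y i) (k + 1) x} := by
    ext y
    simp only [Set.mem_inter_iff, Set.mem_ofPred_eq, funext_iff, block, Fin.forall_fin_succ,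
      Fin.val_zero, Fin.val_succ]
    exact and_comm
  have hinv : ν.real {y : ℕ → α | block (fun i (y : ℕ → α) => y (i + 1)) k y =
      block (fun i (y : ℕ → α) => y (i + 1)) k x} =
      ν.real {y | block (fun i (y : ℕ → α) => y i) k y = block (fun i y => y i) k (shift x)} := by
    have hms : MeasurableSet {y : ℕ → α |
        block (fun i (y : ℕ → α) => y i) k y = block (fun i y => y i) k (shift x)} :=
      measurable_block (fun i => measurable_pi_apply i) k (measurableSet_singleton _)
    exact hT.measureReal_preimage hms.nullMeasurableSet
  rw [hinter, hinv] at hmul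
  have h1 := hx (k + 1)
  have h2 := hTx k
  rw [informationIncr, information, information, fiberProb, neg_sub, neg_sub_neg,
    Real.exp_sub, Real.exp_log h1, Real.exp_log h2, ← hmul]
  exact mul_div_cancel_left₀ _ h2.ne'

/-- The conditional informations of the initial letter are dominated by an integrable function. -/
lemma exists_integrable_dominating_informationIncr (hT : MeasurePreserving shift ν ν) :
    ∃ G : (ℕ → α) → ℝ, Integrable G ν ∧ ∀ᵐ x ∂ν, ∀ k, |informationIncr ν k x| ≤ G x := by
  set F : (ℕ → α) → ENNReal := fun x => ⨆ k, ENNReal.ofReal (informationIncr ν k x) with hF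
  have hFm : Measurable F :=
    Measurable.iSup fun k => (measurable_informationIncr k).ennreal_ofReal
  have hexp := ae_exp_neg_informationIncr hT
  have htail : ∀ j : ℕ, ν {x | (j : ENNReal) < F x} ≤
      (Fintype.card α : ℕ) * ENNReal.ofReal (Real.exp (-j)) := by
    intro j
    -- Splitting by the initial letter makes the event fixed, as the maximal inequality requires;
    -- each letter costs at most `exp (-j)`.
    calc ν {x | (j : ENNReal) < F x} ≤ ν (⋃ a : α, {y : ℕ → α | y 0 = a} ∩ {x | ∃ k,
          fiberProb ν (block (fun i (y : ℕ → α) => y (i + 1)) k) {y | y 0 = a} x <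
            Real.exp (-j)}) := by
          refine measure_mono_ae ?_
          filter_upwards [hexp] with x hx hjx
          obtain ⟨k, hk⟩ := lt_iSup_iff.1 (show (j : ENNReal) < F x from hjx)
          refine Set.mem_iUnion.2 ⟨x 0, rfl, k, ?_⟩
          rw [← hx k]
          refine Real.exp_lt_exp.2 (neg_lt_neg ?_)
          rw [← ENNReal.ofReal_natCast] at hk
          exact lt_of_not_ge fun h => absurd hk (not_lt.2 (ENNReal.ofReal_le_ofReal h))
      _ ≤ ∑ a : α, ENNReal.ofReal (Real.exp (-j)) := by
          refine (measure_iUnion_fintype_le _ _).trans (Finset.sum_le_sum fun a _ => ?_)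
          exact measure_inter_exists_fiberProb_lt_le (fun i => measurable_pi_apply (i + 1))
            (measurableSet_initial_eq a) _
      _ = _ := by simp
  have hfin := lintegral_ne_top_of_exp_tail hFm _ htail
  refine ⟨fun x => (F x).toReal, integrable_toReal_of_lintegral_ne_top hFm.aemeasurable hfin, ?_⟩
  filter_upwards [ae_lt_top hFm hfin, hexp] with x hx hxe k
  have h0 : 0 ≤ informationIncr ν k x := by
    have : Real.exp (-informationIncr ν k x) ≤ 1 := by rw [hxe k]; exact fiberProb_le_one x
    simpa using this
  rw [abs_of_nonneg h0, ← ENNReal.ofReal_le_iff_le_toReal hx.ne]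
  exact le_iSup (fun k => ENNReal.ofReal (informationIncr ν k x)) k

lemma exists_ae_tendsto_informationIncr (hT : MeasurePreserving shift ν ν) :
    ∃ g : (ℕ → α) → ℝ, ∀ᵐ x ∂ν, Tendsto (fun k => informationIncr ν k x) atTop (𝓝 (g x)) := by
  obtain ⟨G, -, hG⟩ := exists_integrable_dominating_informationIncr hT
  have hlim := ae_all_iff.2 fun a : α => ae_tendsto_fiberProb_block (μ := ν)
    (W := fun i (y : ℕ → α) => y (i + 1)) (fun i => measurable_pi_apply (i + 1))
    (measurableSet_initial_eq a)
  have hex : ∀ᵐ x ∂ν, ∃ l, Tendsto (fun k => informationIncr ν k x) atTop (𝓝 l) := by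
    filter_upwards [hG, ae_exp_neg_informationIncr hT, hlim] with x h1 h2 h3
    have h4 := (h3 (x 0)).congr fun k => (h2 k).symm
    set l := (ν[{y : ℕ → α | y 0 = x 0}.indicator (fun _ => (1 : ℝ)) |
      ⨆ t, blockFiltration (W := fun i (y : ℕ → α) => y (i + 1))
        (fun i => measurable_pi_apply (i + 1)) t]) x
    -- The dominating function keeps the limiting conditional probability away from zero, so the
    -- logarithm may be taken in the limit.
    have hl : Real.exp (-G x) ≤ l := ge_of_tendsto' h4 fun k =>
      Real.exp_le_exp.2 (neg_le_neg ((le_abs_self _).trans (h1 k)))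
    have h5 := (h4.log ((Real.exp_pos _).trans_le hl).ne').neg
    exact ⟨_, h5.congr fun k => by rw [Real.log_exp, neg_neg]⟩
  choose! g hg using fun x (h : ∃ l, Tendsto (fun k => informationIncr ν k x) atTop (𝓝 l)) => h
  exact ⟨g, hex.mono hg⟩

/-- The Shannon–McMillan–Breiman theorem on the space of sequences, with the convergence in mean. -/
theorem exists_tendsto_information (hT : Ergodic shift ν) :
    ∃ h : ℝ, Tendsto (fun n : ℕ => (n : ℝ)⁻¹ * ∫ x, information ν n x ∂ν) atTop (𝓝 h) ∧
      ∀ᵐ x ∂ν, Tendsto (fun n : ℕ => (n : ℝ)⁻¹ * information ν n x) atTop (𝓝 h) := by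
  obtain ⟨G, hGi, hG⟩ := exists_integrable_dominating_informationIncr hT.toMeasurePreserving
  obtain ⟨g, hg⟩ := exists_ae_tendsto_informationIncr hT.toMeasurePreserving
  have hm := fun k => measurable_informationIncr (ν := ν) k
  refine ⟨∫ x, g x ∂ν, ?_, ?_⟩
  · have hint : ∀ k, Integrable (informationIncr ν k) ν := fun k =>
      hGi.mono' (hm k).aestronglyMeasurable (hG.mono fun x hx => hx k)
    have hconv : Tendsto (fun k => ∫ x, informationIncr ν k x ∂ν) atTop (𝓝 (∫ x, g x ∂ν)) :=
      tendsto_integral_of_dominated_convergence G (fun k => (hm k).aestronglyMeasurable) hGi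
        (fun k => hG.mono fun x hx => hx k) hg
    refine hconv.cesaro.congr fun n => ?_
    have hit : ∀ i k, Integrable (fun x => informationIncr ν k (shift^[i] x)) ν := fun i k =>
      (hT.toMeasurePreserving.iterate i).integrable_comp_of_integrable (hint k)
    have heq : ∀ i k, ∫ x, informationIncr ν k (shift^[i] x) ∂ν =
        ∫ x, informationIncr ν k x ∂ν := by
      intro i k
      have hi := hT.toMeasurePreserving.iterate i
      have := integral_map (μ := ν) hi.measurable.aemeasurable (f := informationIncr ν k)
        (hm k).aestronglyMeasurable
      rw [← this, hi.map_eq]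
    simp_rw [← sum_informationIncr n]
    rw [integral_finsetSum _ fun i _ => hit i _]
    simp_rw [heq]
    rw [Finset.sum_range_reflect (fun k => ∫ x, informationIncr ν k x ∂ν) n]
  · filter_upwards [ae_tendsto_average_of_dominated hT hGi (fun k => (hm k).aemeasurable) hG hg]
      with x hx
    exact hx.congr fun n => by rw [sum_informationIncr]

end PathSpace

/-! ### Transfer to processes, in bits. -/

section RandomSequence

variable {Ω α : Type*} [MeasurableSpace Ω] {μ : Measure Ω} [MeasurableSpace α]
  [MeasurableSingletonClass α] {W : ℕ → Ω → α}

lemma information_map (hW : ∀ i, Measurable (W i)) [Countable α] (t : ℕ) (ω : Ω) :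
    information (μ.map fun ω i => W i ω) t (fun i => W i ω) =
      -Real.log (wordProb μ W (block W t ω)) := by
  have hb : Measurable (block (fun i (y : ℕ → α) => y i) t) :=
    measurable_block (fun i => measurable_pi_apply i) t
  have hms : MeasurableSet {y : ℕ → α | block (fun i (y : ℕ → α) => y i) t y =
      block (fun i y => y i) t fun i => W i ω} := hb (measurableSet_singleton _)
  rw [information, map_measureReal_apply (measurable_pi_lambda _ hW) hms]
  rfl

variable [IsProbabilityMeasure μ] [Fintype α]

lemma integral_neg_log_wordProb (hW : ∀ i, Measurable (W i)) (t : ℕ) :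
    ∫ ω, -Real.log (wordProb μ W (block W t ω)) ∂μ =
      -∑ u : Fin t → α, wordProb μ W u * Real.log (wordProb μ W u) := by
  have hb := measurable_block hW t
  have : IsProbabilityMeasure (μ.map (block W t)) :=
    Measure.isProbabilityMeasure_map hb.aemeasurable
  have h := integral_map (μ := μ) hb.aemeasurable
    (f := fun u => -Real.log (wordProb μ W u)) (measurable_of_finite _).aestronglyMeasurable
  rw [← h, integral_fintype Integrable.of_finite, ← Finset.sum_neg_distrib]
  refine Finset.sum_congr rfl fun u _ => ?_
  rw [map_measureReal_apply hb (measurableSet_singleton u), smul_eq_mul, mul_neg]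
  rfl

/-- The Shannon–McMillan–Breiman theorem. -/
theorem exists_entropy_rate (hW : ∀ i, Measurable (W i)) (hE : IsStationaryErgodic μ W) :
    ∃ h : ℝ, Tendsto (entropy μ W) atTop (𝓝 h) ∧
      ∀ᵐ ω ∂μ, Tendsto (fun t : ℕ => -(1 / (t : ℝ)) * Real.logb 2 (wordProb μ W (block W t ω)))
        atTop (𝓝 h) := by
  have hpath : Measurable fun ω i => W i ω := measurable_pi_lambda _ hW
  have : IsProbabilityMeasure (μ.map fun ω i => W i ω) :=
    Measure.isProbabilityMeasure_map hpath.aemeasurable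
  obtain ⟨h, h1, h2⟩ := exists_tendsto_information hE
  refine ⟨h / Real.log 2, ?_, ?_⟩
  -- The entropy of order `m` concerns words of length `m + 1`.
  · have h3 := ((tendsto_add_atTop_iff_nat 1).2 h1).div_const (Real.log 2)
    refine h3.congr fun m => ?_
    rw [integral_map hpath.aemeasurable (measurable_information _).aestronglyMeasurable]
    simp_rw [information_map hW]
    rw [integral_neg_log_wordProb hW, entropy]
    simp only [Real.logb, ← mul_div_assoc, ← Finset.sum_div]
    push_cast
    ring
  · filter_upwards [ae_of_ae_map hpath.aemeasurable h2] with ω hω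
    refine (hω.div_const (Real.log 2)).congr fun t => ?_
    rw [information_map hW, Real.logb]
    ring

end RandomSequence

/-! ### Factors of ergodic processes. -/

section Factor

variable {Ω α β : Type*} [MeasurableSpace Ω] {μ : Measure Ω} [MeasurableSpace α]
  [MeasurableSpace β] {W : ℕ → Ω → α}

/-- Letter-to-letter images of stationary ergodic processes are stationary ergodic. -/
lemma IsStationaryErgodic.comp (hW : ∀ i, Measurable (W i)) (hE : IsStationaryErgodic μ W)
    {φ : α → β} (hφ : Measurable φ) : IsStationaryErgodic μ (fun i ω => φ (W i ω)) := by
  have hm : Measurable fun (x : ℕ → α) (i : ℕ) => φ (x i) :=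
    measurable_pi_lambda _ fun i => hφ.comp (measurable_pi_apply i)
  have hmap : (μ.map fun ω i => W i ω).map (fun (x : ℕ → α) (i : ℕ) => φ (x i)) =
      μ.map fun ω i => φ (W i ω) :=
    Measure.map_map hm (measurable_pi_lambda _ hW)
  exact MeasurePreserving.ergodic_of_ergodic_semiconj ⟨hm, hmap⟩ hE measurable_shift
    fun _ => rfl

end Factor

/-! ### Typical words and their number. -/

section Typical

variable {Ω α β : Type*} [MeasurableSpace Ω] {μ : Measure Ω} {X : ℕ → Ω → α} {Z : ℕ → Ω → β}

open Classical in
/-- The words of `X` whose conditional information rate given the word `z` of `Z` is within `η`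
of `h`. -/
noncomputable def typicalSet [Fintype α] (μ : Measure Ω) (X : ℕ → Ω → α) (Z : ℕ → Ω → β)
    (h η : ℝ) (t : ℕ) (z : Fin t → β) : Finset (Fin t → α) :=
  {x | 0 < condWordProb μ X Z x z ∧ |-(1 / (t : ℝ)) * Real.logb 2 (condWordProb μ X Z x z) - h| < η}

lemma mem_typicalSet [Fintype α] {h η : ℝ} {t : ℕ} {z : Fin t → β} {x : Fin t → α} :
    x ∈ typicalSet μ X Z h η t z ↔ 0 < condWordProb μ X Z x z ∧
      |-(1 / (t : ℝ)) * Real.logb 2 (condWordProb μ X Z x z) - h| < η := by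
  simp [typicalSet]

lemma nonempty_of_condSetProb_pos {t : ℕ} {S : Finset (Fin t → α)} {z : Fin t → β}
    (h : 0 < condSetProb μ X Z (S : Set (Fin t → α)) z) : S.Nonempty := by
  by_contra hS
  rw [Finset.not_nonempty_iff_eq_empty] at hS
  subst hS
  simp [condSetProb] at h

lemma condSetProb_le_card_mul {t : ℕ} {S : Finset (Fin t → α)} {z : Fin t → β} {b : ℝ}
    (h : ∀ x ∈ S, condWordProb μ X Z x z ≤ b) :
    condSetProb μ X Z (S : Set (Fin t → α)) z ≤ S.card * b := by
  have hset : {ω | block X t ω ∈ (S : Set (Fin t → α))} =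
      ⋃ x ∈ S, {ω | block X t ω ∈ ({x} : Set (Fin t → α))} := by
    ext ω; simp
  rw [condSetProb, hset, ← nsmul_eq_mul]
  exact (measureReal_biUnion_finset_le _ _).trans (Finset.sum_le_card_nsmul _ _ _ h)

/-- A set of typical words of conditional probability above one half is large. -/
lemma le_logb_card_typicalSet [Fintype α] {h η : ℝ} {t : ℕ} (ht : 0 < t) {z : Fin t → β}
    (hp : 1 / 2 < condSetProb μ X Z (typicalSet μ X Z h η t z : Set (Fin t → α)) z) :
    h - η - 1 / (t : ℝ) ≤ 1 / (t : ℝ) * Real.logb 2 ((typicalSet μ X Z h η t z).card : ℝ) := by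
  have ht' : (0 : ℝ) < t := by exact_mod_cast ht
  have hcard : (0 : ℝ) < (typicalSet μ X Z h η t z).card := by
    exact_mod_cast (nonempty_of_condSetProb_pos (one_half_pos.trans hp)).card_pos
  have hb : ∀ x ∈ typicalSet μ X Z h η t z,
      condWordProb μ X Z x z ≤ (2 : ℝ) ^ (-(t * (h - η))) := by
    intro x hx
    obtain ⟨h0, h1⟩ := mem_typicalSet.1 hx
    rw [← Real.logb_le_iff_le_rpow one_lt_two h0]
    have h2 := (abs_lt.1 h1).1
    have h3 : 1 / (t : ℝ) * Real.logb 2 (condWordProb μ X Z x z) < -(h - η) := by linarith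
    rw [one_div, inv_mul_lt_iff₀ ht'] at h3
    linarith
  -- Mass above `1/2` with each word at most `2^(-t(h-η))` forces the cardinality; the factor `1/2`
  -- costs one bit, hence `1/t`.
  have h1 := hp.trans_le (condSetProb_le_card_mul hb)
  have h2 := Real.logb_lt_logb one_lt_two one_half_pos h1
  rw [Real.logb_mul hcard.ne' (by positivity), Real.logb_rpow two_pos (by norm_num), one_div,
    Real.logb_inv, Real.logb_self_eq_one one_lt_two] at h2
  rw [one_div, ← div_eq_inv_mul, le_div_iff₀ ht']
  have h3 : (h - η - (t : ℝ)⁻¹) * t = t * (h - η) - 1 := by field_simp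
  linarith

/-- A bound uniform in `t`, without which the real-valued `liminf` would not be meaningful. -/
lemma logb_card_div_le [Fintype α] [Nonempty α] {t : ℕ} (S : Finset (Fin t → α)) :
    1 / (t : ℝ) * Real.logb 2 (S.card : ℝ) ≤ Real.logb 2 (Fintype.card α) := by
  have h1 : (1 : ℝ) ≤ Fintype.card α := by exact_mod_cast Fintype.card_pos
  have h0 : 0 ≤ Real.logb 2 (Fintype.card α) := Real.logb_nonneg one_lt_two h1
  rcases Nat.eq_zero_or_pos t with rfl | ht
  · simpa using h0
  rcases S.eq_empty_or_nonempty with rfl | hS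
  · simpa using h0
  have ht' : (0 : ℝ) < t := by exact_mod_cast ht
  have hcard : (S.card : ℝ) ≤ (Fintype.card α : ℝ) ^ t := by
    have := S.card_le_univ
    simp only [Fintype.card_fun, Fintype.card_fin] at this
    exact_mod_cast this
  have hpos : (0 : ℝ) < S.card := by exact_mod_cast hS.card_pos
  have h2 := Real.logb_le_logb_of_le one_lt_two hpos hcard
  rw [Real.logb_pow] at h2
  rwa [one_div, ← div_eq_inv_mul, div_le_iff₀ ht', mul_comm]

end Typical

/-! ### Conditional equipartition. -/

section Conditional

variable {Ω α β : Type*} [MeasurableSpace Ω] {μ : Measure Ω}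
  [MeasurableSpace β] [MeasurableSingletonClass β] {X : ℕ → Ω → α} {Z : ℕ → Ω → β}

lemma wordProb_mul_condWordProb [IsProbabilityMeasure μ] (hZ : ∀ i, Measurable (Z i)) (t : ℕ)
    (ω : Ω) :
    wordProb μ Z (block Z t ω) * condWordProb μ X Z (block X t ω) (block Z t ω) =
      wordProb μ (fun i ω => (X i ω, Z i ω)) (block (fun i ω => (X i ω, Z i ω)) t ω) := by
  have h := cond_real_mul_eq (μ := μ) (E := {ω' | block X t ω' ∈ ({block X t ω} : Set _)})
    (measurable_block hZ t) (block Z t ω)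
  refine h.trans (congrArg μ.real ?_)
  ext ω'
  simp only [Set.mem_inter_iff, Set.mem_ofPred_eq, Set.mem_singleton_iff, funext_iff, block,
    Prod.mk.injEq, forall_and]
  exact and_comm

/-- The event involves a set depending on the outcome through `Z`, but that set is constant on each
fibre of the `Z`-block. -/
lemma fiberProb_eq_condSetProb [Countable β] (hZ : ∀ i, Measurable (Z i))
    (S : (t : ℕ) → (Fin t → β) → Finset (Fin t → α)) (t : ℕ)
    (ω : Ω) :
    fiberProb μ (block Z t) {ω' | block X t ω' ∈ S t (block Z t ω')} ω =
      condSetProb μ X Z (S t (block Z t ω) : Set (Fin t → α)) (block Z t ω) := by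
  have hms : MeasurableSet {ω' | block Z t ω' = block Z t ω} :=
    measurable_block hZ t (measurableSet_singleton _)
  rw [fiberProb, condSetProb, measureReal_def, measureReal_def, cond_apply hms, cond_apply hms]
  congr 3
  ext ω'
  simp only [Set.mem_inter_iff, Set.mem_ofPred_eq, Finset.mem_coe]
  exact and_congr_right fun h => by rw [h]

variable [IsProbabilityMeasure μ] [Fintype α] [MeasurableSpace α] [MeasurableSingletonClass α]
  [Fintype β]

/-- The conditional entropy of order `m` converges, and the conditional information rate converges
almost surely to the same limit. -/
theorem exists_condEntropy_rate (hX : ∀ i, Measurable (X i)) (hZ : ∀ i, Measurable (Z i))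
    (hXZ : IsStationaryErgodic μ (fun i ω => (X i ω, Z i ω))) :
    ∃ h : ℝ, Tendsto (condEntropy μ X Z) atTop (𝓝 h) ∧
      ∀ᵐ ω ∂μ, (∀ t, 0 < condWordProb μ X Z (block X t ω) (block Z t ω)) ∧
        Tendsto (fun t : ℕ => -(1 / (t : ℝ)) *
          Real.logb 2 (condWordProb μ X Z (block X t ω) (block Z t ω))) atTop (𝓝 h) := by
  have hW : ∀ i, Measurable fun ω => (X i ω, Z i ω) := fun i => (hX i).prodMk (hZ i)
  obtain ⟨h₁, h₁e, h₁a⟩ := exists_entropy_rate hW hXZ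
  obtain ⟨h₂, h₂e, h₂a⟩ := exists_entropy_rate hZ (hXZ.comp hW measurable_snd)
  refine ⟨h₁ - h₂, h₁e.sub h₂e, ?_⟩
  have hp₁ := ae_all_iff.2 fun t => ae_fiber_pos (μ := μ) (block (fun i ω => (X i ω, Z i ω)) t)
  have hp₂ := ae_all_iff.2 fun t => ae_fiber_pos (μ := μ) (block Z t)
  filter_upwards [h₁a, h₂a, hp₁, hp₂] with ω h1 h2 h3 h4
  have hpos : ∀ t, 0 < condWordProb μ X Z (block X t ω) (block Z t ω) := fun t =>
    pos_of_mul_pos_right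
      ((wordProb_mul_condWordProb (μ := μ) (X := X) hZ t ω).symm ▸ h3 t) (h4 t).le
  refine ⟨hpos, (h1.sub h2).congr fun t => ?_⟩
  have hz : 0 < wordProb μ Z (block Z t ω) := h4 t
  rw [← wordProb_mul_condWordProb hZ t ω, Real.logb_mul hz.ne' (hpos t).ne']
  ring

/-- Typical words carry almost all conditional probability. -/
lemma ae_tendsto_condSetProb_typicalSet (hX : ∀ i, Measurable (X i)) (hZ : ∀ i, Measurable (Z i))
    {h : ℝ} (hlim : ∀ᵐ ω ∂μ, (∀ t, 0 < condWordProb μ X Z (block X t ω) (block Z t ω)) ∧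
        Tendsto (fun t : ℕ => -(1 / (t : ℝ)) *
          Real.logb 2 (condWordProb μ X Z (block X t ω) (block Z t ω))) atTop (𝓝 h))
    {η : ℝ} (hη : 0 < η) :
    ∀ᵐ ω ∂μ, Tendsto (fun t => condSetProb μ X Z
      (typicalSet μ X Z h η t (block Z t ω) : Set (Fin t → α)) (block Z t ω)) atTop (𝓝 1) := by
  have hm : ∀ t, MeasurableSet
      {ω | block X t ω ∈ typicalSet μ X Z h η t (block Z t ω)} := fun t =>
    measurableSet_preimage ((measurable_block hX t).prodMk (measurable_block hZ t))
      (Set.toFinite {p : (Fin t → α) × (Fin t → β) |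
        p.1 ∈ typicalSet μ X Z h η t p.2}).measurableSet
  have hev : ∀ᵐ ω ∂μ, ∀ᶠ t in atTop,
      ω ∈ {ω | block X t ω ∈ typicalSet μ X Z h η t (block Z t ω)} := by
    filter_upwards [hlim] with ω hω
    filter_upwards [hω.2.eventually (Metric.ball_mem_nhds h hη)] with t ht
    exact mem_typicalSet.2 ⟨hω.1 t, ht⟩
  filter_upwards [ae_tendsto_fiberProb_of_eventually hZ hm hev] with ω hω
  exact hω.congr fun t => fiberProb_eq_condSetProb hZ (fun t => typicalSet μ X Z h η t) t ω

/-- Words of nearly equal conditional probability that carry almost all of it, in a number that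
grows at least at the rate `h`. -/
theorem exists_nearly_equiprobable_sets [Nonempty α] (hX : ∀ i, Measurable (X i))
    (hZ : ∀ i, Measurable (Z i))
    {h : ℝ} (hlim : ∀ᵐ ω ∂μ, (∀ t, 0 < condWordProb μ X Z (block X t ω) (block Z t ω)) ∧
        Tendsto (fun t : ℕ => -(1 / (t : ℝ)) *
          Real.logb 2 (condWordProb μ X Z (block X t ω) (block Z t ω))) atTop (𝓝 h))
    {ε δ : ℝ} (hε : 0 < ε) (hδ : 0 < δ) :
    ∃ Ψ : (t : ℕ) → (Fin t → β) → Finset (Fin t → α),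
      ∀ᵐ ω ∂μ,
        (∃ n' : ℕ, ∀ t : ℕ, n' < t →
          (Ψ t (block Z t ω)).Nonempty ∧
          1 - δ < condSetProb μ X Z (Ψ t (block Z t ω) : Set (Fin t → α)) (block Z t ω) ∧
          (∀ x ∈ Ψ t (block Z t ω), 0 < condWordProb μ X Z x (block Z t ω)) ∧
          (∀ x₁ ∈ Ψ t (block Z t ω), ∀ x₂ ∈ Ψ t (block Z t ω),
            1 / (t : ℝ) * |Real.logb 2 (condWordProb μ X Z x₁ (block Z t ω)) -
              Real.logb 2 (condWordProb μ X Z x₂ (block Z t ω))| < ε)) ∧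
        h ≤ liminf (fun t : ℕ => 1 / (t : ℝ) * Real.logb 2 ((Ψ t (block Z t ω)).card : ℝ))
          atTop := by
  classical
  -- Two rates within `ε / 2` of `h` differ by less than `ε`; `δ` serves the mass bound and `1 / 2`
  -- the counting bound.
  set η₀ : ℝ := min (min (ε / 2) δ) (1 / 2) with hη₀
  have hη₀pos : 0 < η₀ := lt_min (lt_min (half_pos hε) hδ) one_half_pos
  set η : ℕ → ℝ := fun k => η₀ / ((k : ℝ) + 1) with hη
  have hηpos : ∀ k, 0 < η k := fun k => div_pos hη₀pos (Nat.cast_add_one_pos k)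
  have hηanti : Antitone η := fun j k hjk =>
    div_le_div_of_nonneg_left hη₀pos.le (Nat.cast_add_one_pos j)
      (add_le_add_left (Nat.cast_le.2 hjk) _)
  have hηle : ∀ k, η k ≤ η₀ := fun k => (hηanti (Nat.zero_le k)).trans (by simp [hη])
  have hηlim : Tendsto η atTop (𝓝 0) := by
    simpa [hη, div_eq_mul_inv] using (tendsto_one_div_add_atTop_nhds_zero_nat (𝕜 := ℝ)).const_mul η₀
  set Q : (t : ℕ) → (Fin t → β) → ℕ → Prop := fun t z k =>
    1 - η k < condSetProb μ X Z (typicalSet μ X Z h (η k) t z : Set (Fin t → α)) z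
  -- A diagonal choice: the finest tolerance, up to index `t`, at which the typical set still has
  -- mass above `1 - η k`. Almost surely this index tends to infinity, so the growth rate is at
  -- least `h` itself; a fixed tolerance would lose `η`. The default value `0` is harmless, since
  -- `Q` eventually holds at the chosen index.
  set K : (t : ℕ) → (Fin t → β) → ℕ := fun t z => Nat.findGreatest (Q t z) t
  refine ⟨fun t z => typicalSet μ X Z h (η (K t z)) t z, ?_⟩
  have hQ := ae_all_iff.2 fun k => ae_tendsto_condSetProb_typicalSet hX hZ hlim (hηpos k)
  filter_upwards [hQ] with ω hω
  have hK : ∀ k, ∀ᶠ t in atTop, 0 < t ∧ k ≤ K t (block Z t ω) ∧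
      Q t (block Z t ω) (K t (block Z t ω)) := by
    intro k
    filter_upwards [(hω k).eventually (lt_mem_nhds (sub_lt_self 1 (hηpos k))),
      eventually_ge_atTop k, eventually_gt_atTop 0] with t h1 h2 h3
    exact ⟨h3, Nat.le_findGreatest h2 h1, Nat.findGreatest_spec h2 h1⟩
  constructor
  · obtain ⟨n', hn'⟩ := eventually_atTop.1 (hK 0)
    refine ⟨n', fun t ht => ?_⟩
    obtain ⟨ht0, -, hQt⟩ := hn' t ht.le
    set k := K t (block Z t ω)
    have hk := hηle k
    have hk1 : η₀ ≤ ε / 2 := (min_le_left _ _).trans (min_le_left _ _)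
    have hk2 : η₀ ≤ δ := (min_le_left _ _).trans (min_le_right _ _)
    have hk3 : η₀ ≤ 1 / 2 := min_le_right _ _
    refine ⟨nonempty_of_condSetProb_pos (lt_trans (by linarith) hQt),
      lt_of_le_of_lt (by linarith) hQt,
      fun x hx => (mem_typicalSet.1 hx).1, fun x₁ hx₁ x₂ hx₂ => ?_⟩
    have h1 := (mem_typicalSet.1 hx₁).2
    have h2 := (mem_typicalSet.1 hx₂).2
    rw [abs_lt] at h1 h2
    rw [← abs_of_nonneg (show (0 : ℝ) ≤ 1 / t by positivity), ← abs_mul, mul_sub, abs_lt]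
    constructor <;> linarith [h1.1, h1.2, h2.1, h2.2]
  -- For `a < h` one fixed `k` with `h - η k - 1/k > a` suffices, because later tolerances and
  -- values of `1/t` are no larger.
  · refine le_of_forall_lt_imp_le_of_dense fun a ha => ?_
    refine le_liminf_of_le
      (isBoundedUnder_of ⟨_, fun t => logb_card_div_le _⟩).isCoboundedUnder_ge ?_
    have hsum : Tendsto (fun k => h - η k - 1 / (k : ℝ)) atTop (𝓝 (h - 0 - 0)) :=
      (tendsto_const_nhds.sub hηlim).sub tendsto_one_div_atTop_nhds_zero_nat
    rw [sub_zero, sub_zero] at hsum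
    obtain ⟨k, hk, hk0⟩ := ((hsum.eventually (lt_mem_nhds ha)).and (eventually_gt_atTop 0)).exists
    filter_upwards [hK k, eventually_ge_atTop k] with t ht htk
    obtain ⟨ht0, hkK, hQt⟩ := ht
    have hhalf : 1 / 2 ≤ 1 - η (K t (block Z t ω)) := by
      linarith [hηle (K t (block Z t ω)), min_le_right (min (ε / 2) δ) (1 / 2 : ℝ)]
    have h1 := le_logb_card_typicalSet ht0 (hhalf.trans_lt hQt)
    have h2 := hηanti hkK
    have h3 : 1 / (t : ℝ) ≤ 1 / (k : ℝ) :=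
      one_div_le_one_div_of_le (by exact_mod_cast hk0) (by exact_mod_cast htk)
    linarith

end Conditional

end RunningKey

theorem theorem2 {Ω : Type*} [MeasurableSpace Ω] (μ : Measure Ω) [IsProbabilityMeasure μ]
    (n : ℕ) (hn : 2 ≤ n)
    (X Y Z : ℕ → Ω → Fin n)
    (hX : ∀ i, Measurable (X i)) (hY : ∀ i, Measurable (Y i))
    (hXY : IsStationaryErgodic μ (fun i ω => (X i ω, Y i ω)))
    (c d : Fin n → Fin n → Fin n) (hcd : ∀ x y, d (c x y) y = x)
    (hZ : ∀ i ω, Z i ω = c (X i ω) (Y i ω)) :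
    Tendsto (condEntropy μ X Z) atTop (𝓝 (condEntropyRate μ X Z)) ∧
    ∀ ε : ℝ, 0 < ε → ∀ δ : ℝ, 0 < δ →
      ∃ Ψ : (t : ℕ) → (Fin t → Fin n) → Finset (Fin t → Fin n),
        ∀ᵐ ω ∂μ,
          (∃ n' : ℕ, ∀ t : ℕ, n' < t →
            (Ψ t (block Z t ω)).Nonempty ∧
            1 - δ < condSetProb μ X Z (Ψ t (block Z t ω) : Set (Fin t → Fin n)) (block Z t ω) ∧
            (∀ x ∈ Ψ t (block Z t ω), 0 < condWordProb μ X Z x (block Z t ω)) ∧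
            (∀ x₁ ∈ Ψ t (block Z t ω), ∀ x₂ ∈ Ψ t (block Z t ω),
              1 / (t : ℝ) * |Real.logb 2 (condWordProb μ X Z x₁ (block Z t ω)) -
                Real.logb 2 (condWordProb μ X Z x₂ (block Z t ω))| < ε)) ∧
          condEntropyRate μ X Z ≤
            liminf (fun t : ℕ => 1 / (t : ℝ) * Real.logb 2 ((Ψ t (block Z t ω)).card : ℝ))
              atTop := by
  have hφ : Measurable fun p : Fin n × Fin n => (p.1, c p.1 p.2) := measurable_of_finite _
  have hXZ : IsStationaryErgodic μ (fun i ω => (X i ω, Z i ω)) := by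
    have := hXY.comp (fun i => (hX i).prodMk (hY i)) hφ
    simpa only [hZ] using this
  have hZm : ∀ i, Measurable (Z i) := fun i => by
    have : Z i = (fun p : Fin n × Fin n => c p.1 p.2) ∘ fun ω => (X i ω, Y i ω) := funext (hZ i)
    rw [this]
    exact (measurable_of_finite _).comp ((hX i).prodMk (hY i))
  have : Nonempty (Fin n) := ⟨⟨0, by omega⟩⟩
  obtain ⟨h, hconv, hlim⟩ := exists_condEntropy_rate hX hZm hXZ
  have hrate : condEntropyRate μ X Z = h := hconv.limUnder_eq
  rw [hrate]
  exact ⟨hconv, fun ε hε δ hδ => exists_nearly_equiprobable_sets hX hZm hlim hε hδ⟩
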